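/- Let $0<p<1$, $q=1-p$, $s>0$ and $r=1/q$. Let $X_1,X_2,\dots$ be independent, identically distributed random variables (payoffs of a generalized St. Petersburg game) with $$P(X_i=sr^{k-1})=pq^{k-1},\qquad k=1,2,\dots,$$ and let $S_n=\sum_{i=1}^n X_i$. Write $\log_r$ for the logarithm to base $r$. Then, almost surely, $$\limsup_{n\to\infty}\frac{S_n}{n\log_r n}=+\infty\qquad\text{and}\qquad \liminf_{n\to\infty}\frac{S_n}{n\log_r n}=ps .$$ -/

import Mathlib

open MeasureTheory ProbabilityTheory Filter

/-!
A payoff takes the value `s * r ^ k` with probability `p * q ^ k`, and `q * r = 1`, so each level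
contributes `p * s` to the mean. Truncating a payoff to its first `K` levels therefore gives mean
`K * p * s`, while the second moment is at most `s ^ 2 * r ^ K`. With `K = ⌊log_r n⌋ + m`, the
sum `T` of `n` truncated payoffs, divided by `n * log_r n`, has mean tending to `p * s` and variance
`O((log_r n) ^ (-2))`. The variances are summable along `n = ⌊a ^ j⌋` for `a > 1`, so
`T / (n * log_r n)` tends to `p * s` almost surely along that sequence (`ae_tendsto_truncSum`), for every fixed `m`.

* The sums `S` are monotone in `n` and dominate `T`, so interpolating between consecutive terms
  `⌊a ^ j⌋` gives a lower limit of at least `p * s / a` (`ae_eventually_le_div`); then `a` decreases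
  to `1`.
* The event `S ≠ T` has probability at most `r * q ^ m`, uniformly in `n`. Hence, almost surely,
  there is an `m` for which `S = T` infinitely often along `⌊2 ^ j⌋`, and the lower limit is at most
  `p * s` (`ae_frequently_div_le`).
* A single payoff exceeds `x` with probability at least of order `1 / x`, and
  `∑ 1 / (n * log_r n)` diverges. By the second Borel–Cantelli lemma one payoff alone exceeds
  `M * n * log_r n` infinitely often, for every `M` (`ae_frequently_le_payoff`), so the upper limit
  is infinite.
-/

open scoped Topology

/-! ### Geometric subsequences and the series `∑ 1 / (n log n)` -/

theorem tendsto_floor_pow_atTop {a : ℝ} (ha : 1 < a) :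
    Tendsto (fun j : ℕ => ⌊a ^ j⌋₊) atTop atTop :=
  tendsto_nat_floor_atTop.comp (tendsto_pow_atTop_atTop_of_one_lt ha)

theorem tendsto_floor_pow_div_pow {a : ℝ} (ha : 1 < a) :
    Tendsto (fun j : ℕ => (⌊a ^ j⌋₊ : ℝ) / a ^ j) atTop (𝓝 1) :=
  (tendsto_nat_floor_div_atTop (R := ℝ)).comp (tendsto_pow_atTop_atTop_of_one_lt ha)

theorem tendsto_logb_floor_pow_div {a r : ℝ} (ha : 1 < a) :
    Tendsto (fun j : ℕ => Real.logb r ⌊a ^ j⌋₊ / j) atTop (𝓝 (Real.logb r a)) := by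
  have h1 : Tendsto (fun j : ℕ => Real.logb r ((⌊a ^ j⌋₊ : ℝ) / a ^ j)) atTop (𝓝 0) := by
    have := ((Real.continuousAt_log one_ne_zero).tendsto.comp
      (tendsto_floor_pow_div_pow ha)).div_const (Real.log r)
    simpa [Real.logb, Function.comp_def] using this
  have h2 := (h1.div_atTop tendsto_natCast_atTop_atTop).const_add (Real.logb r a)
  rw [add_zero] at h2
  refine h2.congr' ?_
  filter_upwards [eventually_gt_atTop 0,
    (tendsto_floor_pow_atTop ha).eventually_gt_atTop 0] with j hj hN
  have ha0 : a ^ j ≠ 0 := by positivity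
  have hj' : (j : ℝ) ≠ 0 := by positivity
  rw [Real.logb_div (by positivity) ha0, Real.logb_pow]
  field_simp
  ring

theorem summable_inv_logb_floor_pow_sq {a r : ℝ} (ha : 1 < a) (hr : 1 < r) :
    Summable fun j : ℕ => (Real.logb r ⌊a ^ j⌋₊ ^ 2)⁻¹ := by
  have hl : 0 < Real.logb r a := Real.logb_pos hr ha
  refine Summable.of_norm_bounded_eventually_nat
    (((Real.summable_nat_pow_inv (p := 2)).2 (by norm_num)).mul_left
      (((Real.logb r a / 2) ^ 2)⁻¹)) ?_
  filter_upwards [eventually_gt_atTop 0, (tendsto_logb_floor_pow_div ha).eventually_const_le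
    (half_lt_self hl)] with j hj hle
  have hj' : (0 : ℝ) < j := by exact_mod_cast hj
  rw [le_div_iff₀ hj'] at hle
  rw [Real.norm_of_nonneg (by positivity), ← mul_inv, ← mul_pow]
  gcongr

/-- Consecutive terms of `n * log_r n` along `⌊a ^ j⌋` differ asymptotically by the factor `a`. -/
theorem tendsto_floor_pow_mul_logb_div {a r : ℝ} (ha : 1 < a) (hr : 1 < r) :
    Tendsto (fun j : ℕ => (⌊a ^ j⌋₊ * Real.logb r ⌊a ^ j⌋₊) /
      (a ^ (j + 1) * Real.logb r (a ^ (j + 1)))) atTop (𝓝 a⁻¹) := by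
  have hl : 0 < Real.logb r a := Real.logb_pos hr ha
  have h := (((tendsto_floor_pow_div_pow ha).mul (tendsto_logb_floor_pow_div (r := r) ha)).mul
    (tendsto_natCast_div_add_atTop (1 : ℝ))).mul_const (a * Real.logb r a)⁻¹
  have e : 1 * Real.logb r a * 1 * (a * Real.logb r a)⁻¹ = a⁻¹ := by field_simp
  rw [e] at h
  refine h.congr' ?_
  filter_upwards [eventually_gt_atTop 0] with j hj
  have hj' : (0 : ℝ) < j := by exact_mod_cast hj
  have ha0 : 0 < a := by linarith
  rw [Real.logb_pow, pow_succ]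
  push_cast
  field_simp

/-- Cauchy condensation reduces this to the harmonic series. The term at `n = 1` is `0⁻¹ = 0`, so
the sequence is antitone only from `n = 2` on. -/
theorem not_summable_inv_mul_logb {r : ℝ} (hr : 1 < r) :
    ¬ Summable fun n : ℕ => ((n : ℝ) * Real.logb r n)⁻¹ := by
  have hl : 0 < Real.logb r 2 := Real.logb_pos hr one_lt_two
  rw [← summable_condensed_iff_of_eventually_nonneg]
  · have : ∀ k : ℕ, (2 : ℝ) ^ k * (((2 ^ k : ℕ) : ℝ) * Real.logb r (2 ^ k : ℕ))⁻¹ =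
        (Real.logb r 2)⁻¹ * (k : ℝ)⁻¹ := by
      intro k
      push_cast
      rw [Real.logb_pow, mul_inv, mul_inv, mul_inv_cancel_left₀ (by positivity), mul_comm]
    simp_rw [this]
    rw [summable_mul_left_iff (inv_ne_zero hl.ne')]
    exact Real.not_summable_natCast_inv
  · filter_upwards [eventually_ge_atTop 1] with n hn
    have := Real.logb_nonneg hr (x := n) (by exact_mod_cast hn)
    simp only [Pi.zero_apply]
    positivity
  · filter_upwards [eventually_ge_atTop 2] with n hn
    have hn' : (2 : ℝ) ≤ n := by exact_mod_cast hn
    have h0 : 0 < Real.logb r n := Real.logb_pos hr (by linarith)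
    have h1 : Real.logb r n ≤ Real.logb r (n + 1 : ℕ) :=
      Real.logb_le_logb_of_le hr (by linarith) (by push_cast; linarith)
    have h2 : (n : ℝ) ≤ (n + 1 : ℕ) := by push_cast; linarith
    gcongr

/-! ### Almost sure convergence from summable variances -/

/-- A second-moment Borel–Cantelli argument: the expectation of `∑ j, (W j - E[W j]) ^ 2` is finite,
hence so is the sum almost surely. -/
theorem ae_tendsto_sub_integral_of_summable_variance {Ω : Type*} [MeasurableSpace Ω]
    {P : Measure Ω} [IsFiniteMeasure P] {W : ℕ → Ω → ℝ} (hW : ∀ j, MemLp (W j) 2 P)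
    (hsum : Summable fun j => Var[W j; P]) :
    ∀ᵐ ω ∂P, Tendsto (fun j => W j ω - ∫ ω', W j ω' ∂P) atTop (𝓝 0) := by
  have hm : ∀ j, AEMeasurable (fun ω => ENNReal.ofReal ((W j ω - ∫ ω', W j ω' ∂P) ^ 2)) P :=
    fun j => (((hW j).1.aemeasurable.sub_const _).pow_const 2).ennreal_ofReal
  have hfin : ∫⁻ ω, ∑' j, ENNReal.ofReal ((W j ω - ∫ ω', W j ω' ∂P) ^ 2) ∂P ≠ ⊤ := by
    rw [lintegral_tsum hm]
    simp_rw [← evariance_eq_lintegral_ofReal, ← (hW _).ofReal_variance_eq]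
    exact hsum.tsum_ofReal_ne_top
  filter_upwards [ae_lt_top' (AEMeasurable.tsum hm) hfin] with ω hω
  have h0 := ENNReal.tendsto_atTop_zero_of_tsum_ne_top hω.ne
  have h1 : Tendsto (fun j => (W j ω - ∫ ω', W j ω' ∂P) ^ 2) atTop (𝓝 0) := by
    have := (ENNReal.tendsto_toReal ENNReal.zero_ne_top).comp h0
    simpa [Function.comp_def, ENNReal.toReal_ofReal (sq_nonneg _)] using this
  have h2 := (Real.continuous_sqrt.tendsto 0).comp h1
  simp only [Function.comp_def, Real.sqrt_sq_eq_abs, Real.sqrt_zero] at h2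
  exact (tendsto_zero_iff_abs_tendsto_zero _).2 h2

/-! ### The game and its truncated payoffs -/

/-- The payoffs `X 0, X 1, …` of independent generalized St. Petersburg games with success
probability `p`, failure probability `q`, payoff ratio `r = q⁻¹` and smallest payoff `s`. The levels
`s * r ^ k` are indexed from `k = 0`. -/
structure IsPetersburgSequence {Ω : Type*} [MeasurableSpace Ω] (P : Measure Ω) (p q r s : ℝ)
    (X : ℕ → Ω → ℝ) : Prop where
  p_pos : 0 < p
  q_pos : 0 < q
  add_eq_one : p + q = 1
  mul_eq_one : q * r = 1
  s_pos : 0 < s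
  measurable : ∀ i, Measurable (X i)
  indep : iIndepFun X P
  law : ∀ i k, P.real {ω | X i ω = s * r ^ k} = p * q ^ k

/-- The payoff `x`, replaced by `0` unless it is one of the first `K` levels `s * r ^ k`. -/
noncomputable def truncPayoff (r s : ℝ) (K : ℕ) (x : ℝ) : ℝ :=
  ∑ k ∈ Finset.range K, if x = s * r ^ k then s * r ^ k else 0

/-- The sum of the first `n` payoffs, each truncated to its first `⌊log_r n⌋ + m` levels. -/
noncomputable def truncSum {Ω : Type*} (r s : ℝ) (X : ℕ → Ω → ℝ) (m n : ℕ) (ω : Ω) : ℝ :=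
  ∑ i ∈ Finset.range n, truncPayoff r s (⌊Real.logb r n⌋₊ + m) (X i ω)

theorem measurable_truncPayoff (r s : ℝ) (K : ℕ) : Measurable (truncPayoff r s K) :=
  Finset.measurable_sum _ fun _ _ =>
    Measurable.ite (measurableSet_singleton _) measurable_const measurable_const

namespace IsPetersburgSequence

variable {Ω : Type*} [MeasurableSpace Ω] {P : Measure Ω} {p q r s : ℝ} {X : ℕ → Ω → ℝ}

theorem r_pos (h : IsPetersburgSequence P p q r s X) : 0 < r :=
  pos_of_mul_pos_right (h.mul_eq_one ▸ one_pos) h.q_pos.le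

theorem one_lt_r (h : IsPetersburgSequence P p q r s X) : 1 < r := by
  have := h.p_pos; have := h.q_pos; have := h.add_eq_one; have := h.mul_eq_one
  nlinarith [h.r_pos]

theorem q_lt_one (h : IsPetersburgSequence P p q r s X) : q < 1 := by
  linarith [h.p_pos, h.add_eq_one]

theorem pow_mul_pow (h : IsPetersburgSequence P p q r s X) (k : ℕ) : q ^ k * r ^ k = 1 := by
  rw [← mul_pow, h.mul_eq_one, one_pow]

theorem level_injective (h : IsPetersburgSequence P p q r s X) :
    Function.Injective fun k : ℕ => s * r ^ k :=
  fun _ _ hab => (pow_right_strictMono₀ h.one_lt_r).injective (mul_left_cancel₀ h.s_pos.ne' hab)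

theorem measurableSet_level (h : IsPetersburgSequence P p q r s X) (i : ℕ) (c : ℝ) :
    MeasurableSet {ω | X i ω = c} :=
  h.measurable i (measurableSet_singleton c)

theorem truncPayoff_level (h : IsPetersburgSequence P p q r s X) {K k : ℕ} (hk : k < K) :
    truncPayoff r s K (s * r ^ k) = s * r ^ k := by
  rw [truncPayoff, Finset.sum_eq_single_of_mem k (Finset.mem_range.2 hk)]
  · simp
  · intro b _ hb
    exact if_neg fun e => hb (h.level_injective e).symm

theorem truncPayoff_eq_zero {K : ℕ} {x : ℝ} (hx : ∀ k < K, x ≠ s * r ^ k) :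
    truncPayoff r s K x = 0 :=
  Finset.sum_eq_zero fun k hk => if_neg (hx k (Finset.mem_range.1 hk))

theorem truncPayoff_le (h : IsPetersburgSequence P p q r s X) (K : ℕ) {x : ℝ} (hx : 0 ≤ x) :
    truncPayoff r s K x ≤ x := by
  by_cases hk : ∃ k < K, x = s * r ^ k
  · obtain ⟨k, hk, rfl⟩ := hk
    exact (h.truncPayoff_level hk).le
  · push Not at hk
    rwa [truncPayoff_eq_zero hk]

theorem truncPayoff_sq (h : IsPetersburgSequence P p q r s X) (K : ℕ) (x : ℝ) :
    truncPayoff r s K x ^ 2 =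
      ∑ k ∈ Finset.range K, if x = s * r ^ k then (s * r ^ k) ^ 2 else 0 := by
  by_cases hk : ∃ k < K, x = s * r ^ k
  · obtain ⟨k, hk, rfl⟩ := hk
    rw [h.truncPayoff_level hk, Finset.sum_eq_single_of_mem k (Finset.mem_range.2 hk)]
    · simp
    · intro b _ hb
      exact if_neg fun e => hb (h.level_injective e).symm
  · push Not at hk
    rw [truncPayoff_eq_zero hk, Finset.sum_eq_zero]
    · simp
    · exact fun k hk' => if_neg (hk k (Finset.mem_range.1 hk'))

theorem truncSum_le_sum (h : IsPetersburgSequence P p q r s X) {ω : Ω} (hω : ∀ i, 0 ≤ X i ω)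
    (m : ℕ) {n n' : ℕ} (hn : n ≤ n') :
    truncSum r s X m n ω ≤ ∑ i ∈ Finset.range n', X i ω :=
  (Finset.sum_le_sum fun i _ => h.truncPayoff_le _ (hω i)).trans
    (Finset.sum_le_sum_of_subset_of_nonneg (Finset.range_mono hn) fun i _ _ => hω i)

/-! ### Moments of the truncated payoffs -/

variable [IsProbabilityMeasure P]

theorem integral_sum_levels (h : IsPetersburgSequence P p q r s X) (i K : ℕ) (c : ℕ → ℝ) :
    ∫ ω, (∑ k ∈ Finset.range K, if X i ω = s * r ^ k then c k else 0) ∂P =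
      ∑ k ∈ Finset.range K, p * q ^ k * c k := by
  have hind : ∀ k, (fun ω => if X i ω = s * r ^ k then c k else 0) =
      {ω | X i ω = s * r ^ k}.indicator fun _ => c k := by
    intro k; ext ω; simp [Set.indicator_apply]
  rw [integral_finsetSum]
  · refine Finset.sum_congr rfl fun k _ => ?_
    rw [hind, integral_indicator_const _ (h.measurableSet_level i _), h.law, smul_eq_mul]
  · intro k _
    rw [hind]
    exact (integrable_const _).indicator (h.measurableSet_level i _)

theorem integral_truncPayoff (h : IsPetersburgSequence P p q r s X) (i K : ℕ) :
    ∫ ω, truncPayoff r s K (X i ω) ∂P = K * (p * s) := by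
  have hk : ∀ k ∈ Finset.range K, p * q ^ k * (s * r ^ k) = p * s := fun k _ => by
    linear_combination p * s * h.pow_mul_pow k
  simp only [truncPayoff]
  rw [h.integral_sum_levels i K fun k => s * r ^ k, Finset.sum_congr rfl hk]
  simp

theorem integral_truncPayoff_sq_le (h : IsPetersburgSequence P p q r s X) (i K : ℕ) :
    ∫ ω, truncPayoff r s K (X i ω) ^ 2 ∂P ≤ s ^ 2 * r ^ K := by
  have hk : ∀ k ∈ Finset.range K, p * q ^ k * (s * r ^ k) ^ 2 = p * s ^ 2 * r ^ k := fun k _ => by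
    linear_combination p * s ^ 2 * r ^ k * h.pow_mul_pow k
  simp only [h.truncPayoff_sq]
  rw [h.integral_sum_levels i K fun k => (s * r ^ k) ^ 2, Finset.sum_congr rfl hk, ← Finset.mul_sum]
  -- This identity collapses the geometric sum to `q * (r ^ K - 1)`.
  have hpqr : p = q * (r - 1) := by linear_combination h.add_eq_one - h.mul_eq_one
  have hq1 : q ≤ 1 := by linarith [h.p_pos, h.add_eq_one]
  calc p * s ^ 2 * ∑ k ∈ Finset.range K, r ^ k
      = s ^ 2 * (q * ((∑ k ∈ Finset.range K, r ^ k) * (r - 1))) := by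
        linear_combination s ^ 2 * (∑ k ∈ Finset.range K, r ^ k) * hpqr
    _ = s ^ 2 * (q * (r ^ K - 1)) := by rw [geom_sum_mul]
    _ ≤ s ^ 2 * r ^ K := by
        have := one_le_pow₀ h.one_lt_r.le (n := K)
        refine mul_le_mul_of_nonneg_left ?_ (sq_nonneg s)
        nlinarith [h.q_pos]

theorem memLp_truncPayoff (h : IsPetersburgSequence P p q r s X) (i K : ℕ) :
    MemLp (fun ω => truncPayoff r s K (X i ω)) 2 P := by
  refine MemLp.of_bound ((measurable_truncPayoff r s K).comp (h.measurable i)).aestronglyMeasurable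
    (∑ k ∈ Finset.range K, s * r ^ k) (ae_of_all _ fun ω => ?_)
  have hpos : ∀ k, 0 < s * r ^ k := fun k => mul_pos h.s_pos (pow_pos h.r_pos k)
  refine (norm_sum_le _ _).trans (Finset.sum_le_sum fun k _ => ?_)
  split_ifs
  · exact (Real.norm_of_nonneg (hpos k).le).le
  · simpa using (hpos k).le

theorem memLp_truncSum (h : IsPetersburgSequence P p q r s X) (m n : ℕ) :
    MemLp (truncSum r s X m n) 2 P :=
  memLp_finsetSum _ fun i _ => h.memLp_truncPayoff i _

theorem integral_truncSum (h : IsPetersburgSequence P p q r s X) (m n : ℕ) :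
    ∫ ω, truncSum r s X m n ω ∂P = n * ((⌊Real.logb r n⌋₊ + m : ℕ) * (p * s)) := by
  simp only [truncSum]
  rw [integral_finsetSum _ fun i _ => (h.memLp_truncPayoff i _).integrable (by norm_num)]
  simp [h.integral_truncPayoff]

theorem variance_truncSum_le (h : IsPetersburgSequence P p q r s X) (m n : ℕ) :
    Var[truncSum r s X m n; P] ≤ n ^ 2 * (s ^ 2 * r ^ m) := by
  set K := ⌊Real.logb r n⌋₊ + m with hK
  have hfun : truncSum r s X m n =
      ∑ i ∈ Finset.range n, fun ω => truncPayoff r s K (X i ω) := by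
    ext ω; simp [truncSum, hK]
  rw [hfun, IndepFun.variance_sum fun i _ => h.memLp_truncPayoff i K]
  · have hpow : (n : ℝ) ≠ 0 → r ^ K ≤ n * r ^ m := fun hn => by
      have hn : 0 < n := Nat.pos_of_ne_zero (by simpa using hn)
      have hn1 : (1 : ℝ) ≤ n := by exact_mod_cast hn
      rw [hK, pow_add]
      refine mul_le_mul_of_nonneg_right ?_ (pow_pos h.r_pos m).le
      rw [← Real.rpow_natCast, ← Real.le_logb_iff_rpow_le h.one_lt_r (by linarith)]
      exact Nat.floor_le (Real.logb_nonneg h.one_lt_r hn1)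
    rcases eq_or_ne (n : ℝ) 0 with hn | hn
    · have : n = 0 := by exact_mod_cast hn
      simp [this]
    calc ∑ i ∈ Finset.range n, Var[fun ω => truncPayoff r s K (X i ω); P]
        ≤ ∑ _i ∈ Finset.range n, s ^ 2 * r ^ K := Finset.sum_le_sum fun i _ =>
          (variance_le_expectation_sq (h.memLp_truncPayoff i K).1).trans
            (h.integral_truncPayoff_sq_le i K)
      _ = n * (s ^ 2 * r ^ K) := by simp
      _ ≤ n * (s ^ 2 * (n * r ^ m)) := by gcongr; exact hpow hn
      _ = _ := by ring
  · intro i _ j _ hij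
    exact (h.indep.indepFun hij).comp (measurable_truncPayoff r s K) (measurable_truncPayoff r s K)

/-! ### Concentration of the truncated sums -/

/-- Summability of the variances makes the truncated sums concentrate along every subsequence on
which `(log_r n)⁻²` is summable, whatever the fixed margin `m` of the truncation. -/
theorem ae_tendsto_truncSum (h : IsPetersburgSequence P p q r s X) (m : ℕ) {N : ℕ → ℕ}
    (hN : Tendsto N atTop atTop) (hsum : Summable fun j => (Real.logb r (N j) ^ 2)⁻¹) :
    ∀ᵐ ω ∂P, Tendsto (fun j => truncSum r s X m (N j) ω / (N j * Real.logb r (N j)))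
      atTop (𝓝 (p * s)) := by
  set W : ℕ → Ω → ℝ := fun j ω =>
    truncSum r s X m (N j) ω * ((N j : ℝ) * Real.logb r (N j))⁻¹ with hWdef
  have hW : ∀ j, MemLp (W j) 2 P := fun j => (h.memLp_truncSum m (N j)).mul_const _
  have hvar : Summable fun j => Var[W j; P] := by
    refine Summable.of_nonneg_of_le (fun j => variance_nonneg _ _) (fun j => ?_)
      (hsum.mul_left (s ^ 2 * r ^ m))
    rw [hWdef, variance_mul_const]
    have hb := h.variance_truncSum_le m (N j)
    rcases eq_or_ne (N j : ℝ) 0 with h0 | h0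
    · simp [h0]
    calc Var[truncSum r s X m (N j); P] * ((N j * Real.logb r (N j))⁻¹) ^ 2
        ≤ (N j ^ 2 * (s ^ 2 * r ^ m)) * ((N j * Real.logb r (N j))⁻¹) ^ 2 := by gcongr
      _ = s ^ 2 * r ^ m * (Real.logb r (N j) ^ 2)⁻¹ := by
        rw [mul_inv, mul_pow, inv_pow, inv_pow]; field_simp
  have hNr : Tendsto (fun j => (N j : ℝ)) atTop atTop := tendsto_natCast_atTop_atTop.comp hN
  have hL : Tendsto (fun j => Real.logb r (N j)) atTop atTop :=
    (Real.tendsto_logb_atTop h.one_lt_r).comp hNr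
  have hmean : Tendsto (fun j => ∫ ω, W j ω ∂P) atTop (𝓝 (p * s)) := by
    have h1 : Tendsto (fun j => ((⌊Real.logb r (N j)⌋₊ : ℝ) / Real.logb r (N j) +
        m / Real.logb r (N j)) * (p * s)) atTop (𝓝 ((1 + 0) * (p * s))) :=
      (((tendsto_nat_floor_div_atTop (R := ℝ)).comp hL).add
        (tendsto_const_nhds.div_atTop hL)).mul_const _
    rw [add_zero, one_mul] at h1
    refine h1.congr' ?_
    filter_upwards [hNr.eventually_gt_atTop 0, hL.eventually_gt_atTop 0] with j hj hLj
    rw [hWdef, integral_mul_const, h.integral_truncSum]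
    push_cast
    field_simp
  filter_upwards [ae_tendsto_sub_integral_of_summable_variance hW hvar] with ω hω
  simpa [hWdef, div_eq_mul_inv] using hω.add hmean

/-! ### Tails and levels -/

theorem measureReal_forall_ne_level (h : IsPetersburgSequence P p q r s X) (i K : ℕ) :
    P.real {ω | ∀ k < K, X i ω ≠ s * r ^ k} = q ^ K := by
  have hset : {ω | ∀ k < K, X i ω ≠ s * r ^ k} =
      (⋃ k ∈ Finset.range K, {ω | X i ω = s * r ^ k})ᶜ := by
    ext ω; simp
  rw [hset, probReal_compl_eq_one_sub
    (Finset.measurableSet_biUnion _ fun k _ => h.measurableSet_level i _),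
    measureReal_biUnion_finset]
  · simp_rw [h.law]
    rw [← Finset.mul_sum, show p = 1 - q by linarith [h.add_eq_one], mul_neg_geom_sum]
    ring
  · intro k _ l _ hkl
    refine Set.disjoint_left.2 fun ω hk hl => hkl (h.level_injective ?_)
    exact (Set.mem_ofPred_eq ▸ hk).symm.trans hl
  · exact fun k _ => h.measurableSet_level i _

theorem ae_exists_level (h : IsPetersburgSequence P p q r s X) :
    ∀ᵐ ω ∂P, ∀ i, ∃ k : ℕ, X i ω = s * r ^ k := by
  refine ae_all_iff.2 fun i => ?_
  rw [ae_iff, ← measureReal_eq_zero_iff]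
  refine le_antisymm (ge_of_tendsto' (tendsto_pow_atTop_nhds_zero_of_lt_one h.q_pos.le h.q_lt_one)
    fun K => ?_) measureReal_nonneg
  rw [← h.measureReal_forall_ne_level i K]
  refine measureReal_mono fun ω hω k _ hk => hω ⟨k, hk⟩

theorem ae_nonneg (h : IsPetersburgSequence P p q r s X) : ∀ᵐ ω ∂P, ∀ i, 0 ≤ X i ω := by
  filter_upwards [h.ae_exists_level] with ω hω i
  obtain ⟨k, hk⟩ := hω i
  rw [hk]
  exact mul_nonneg h.s_pos.le (pow_pos h.r_pos k).le

/-! ### Lower bound for all large `n` -/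

/-- The sums dominate their truncations along `⌊a ^ j⌋`, and monotonicity of the sums fills the gaps
between consecutive terms at the cost of the factor `a`. -/
theorem ae_eventually_le_div (h : IsPetersburgSequence P p q r s X) {a : ℝ} (ha : 1 < a) :
    ∀ᵐ ω ∂P, ∀ c < p * s * a⁻¹, ∀ᶠ n : ℕ in atTop,
      c ≤ (∑ i ∈ Finset.range n, X i ω) / (n * Real.logb r n) := by
  filter_upwards [h.ae_nonneg, h.ae_tendsto_truncSum 0 (tendsto_floor_pow_atTop ha)
    (summable_inv_logb_floor_pow_sq ha h.one_lt_r)] with ω hω hT c hc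
  have ha0 : 0 < a := by linarith
  have hnr : Tendsto (fun n : ℕ => ⌊Real.logb a n⌋₊) atTop atTop :=
    tendsto_nat_floor_atTop.comp ((Real.tendsto_logb_atTop ha).comp tendsto_natCast_atTop_atTop)
  have hlim := (hT.mul (tendsto_floor_pow_mul_logb_div ha h.one_lt_r)).eventually_const_le hc
  have hpos : ∀ᶠ j : ℕ in atTop, (⌊a ^ j⌋₊ : ℝ) * Real.logb r ⌊a ^ j⌋₊ ≠ 0 := by
    filter_upwards [(tendsto_floor_pow_atTop ha).eventually_ge_atTop 2] with j hj
    have hj' : (2 : ℝ) ≤ ⌊a ^ j⌋₊ := by exact_mod_cast hj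
    exact (mul_pos (by linarith) (Real.logb_pos h.one_lt_r (by linarith))).ne'
  filter_upwards [hnr.eventually hlim, hnr.eventually hpos, eventually_ge_atTop 2] with n hn hp0 hn2
  have hn2' : (2 : ℝ) ≤ n := by exact_mod_cast hn2
  -- `j` is the index with `a ^ j ≤ n < a ^ (j + 1)`.
  set j := ⌊Real.logb a n⌋₊ with hj
  rw [div_mul_div_cancel₀ hp0] at hn
  have hlow : a ^ j ≤ n := by
    rw [← Real.rpow_natCast, ← Real.le_logb_iff_rpow_le ha (by linarith)]
    exact Nat.floor_le (Real.logb_nonneg ha (by linarith))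
  have hupp : (n : ℝ) ≤ a ^ (j + 1) := by
    rw [← Real.rpow_natCast, ← Real.logb_le_iff_le_rpow ha (by linarith)]
    push_cast
    exact (Nat.lt_floor_add_one _).le
  have hNn : ⌊a ^ j⌋₊ ≤ n := Nat.floor_le_of_le hlow
  have hL : 0 < Real.logb r n := Real.logb_pos h.one_lt_r (by linarith)
  refine hn.trans (div_le_div₀ (Finset.sum_nonneg fun i _ => hω i) (h.truncSum_le_sum hω 0 hNn)
    (by positivity) ?_)
  have := Real.logb_le_logb_of_le h.one_lt_r (by linarith) hupp
  gcongr

/-! ### Upper bound for infinitely many `n` -/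

/-- Each of the `n` payoffs exceeds the truncation level with probability at most
`q ^ (log_r n - 1 + m) = r * q ^ m / n`. -/
theorem measureReal_sum_ne_truncSum_le (h : IsPetersburgSequence P p q r s X) (m n : ℕ) :
    P.real {ω | ∑ i ∈ Finset.range n, X i ω ≠ truncSum r s X m n ω} ≤ r * q ^ m := by
  set K := ⌊Real.logb r n⌋₊ + m with hK
  have hsub : {ω | ∑ i ∈ Finset.range n, X i ω ≠ truncSum r s X m n ω} ⊆
      ⋃ i ∈ Finset.range n, {ω | ∀ k < K, X i ω ≠ s * r ^ k} := by
    intro ω hω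
    by_contra hcon
    refine hω (Finset.sum_congr rfl fun i hi => ?_)
    simp only [Set.mem_iUnion, not_exists] at hcon
    have := hcon i hi
    simp only [Set.mem_ofPred_eq] at this
    push Not at this
    obtain ⟨k, hk, hX⟩ := this
    rw [hX, h.truncPayoff_level hk]
  refine (measureReal_mono hsub (measure_ne_top _ _)).trans
    ((measureReal_biUnion_finset_le _ _).trans ?_)
  simp_rw [h.measureReal_forall_ne_level]
  rw [Finset.sum_const, Finset.card_range, nsmul_eq_mul, hK, pow_add, ← mul_assoc]
  refine mul_le_mul_of_nonneg_right ?_ (pow_pos h.q_pos m).le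
  rcases Nat.eq_zero_or_pos n with rfl | hn
  · simpa using h.r_pos.le
  have hupp : (n : ℝ) ≤ r ^ (⌊Real.logb r n⌋₊ + 1) := by
    rw [← Real.rpow_natCast, ← Real.logb_le_iff_le_rpow h.one_lt_r (by exact_mod_cast hn)]
    push_cast
    exact (Nat.lt_floor_add_one _).le
  have := h.q_pos
  calc (n : ℝ) * q ^ ⌊Real.logb r n⌋₊
      ≤ r ^ (⌊Real.logb r n⌋₊ + 1) * q ^ ⌊Real.logb r n⌋₊ := by gcongr
    _ = r := by linear_combination r * h.pow_mul_pow ⌊Real.logb r n⌋₊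

/-- If no `m` worked, then for every `m` the sums would differ from their truncations for all large
`j`, an event of probability at most `r * q ^ m`. -/
theorem ae_exists_frequently_sum_eq_truncSum (h : IsPetersburgSequence P p q r s X)
    (N : ℕ → ℕ) : ∀ᵐ ω ∂P, ∃ m, ∃ᶠ j in atTop,
      ∑ i ∈ Finset.range (N j), X i ω = truncSum r s X m (N j) ω := by
  set A : ℕ → ℕ → Set Ω := fun m j =>
    {ω | ∑ i ∈ Finset.range (N j), X i ω ≠ truncSum r s X m (N j) ω} with hA
  have hle : ∀ m, P (⋃ J, ⋂ j ≥ J, A m j) ≤ ENNReal.ofReal (r * q ^ m) := by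
    intro m
    have hmono : Monotone fun J => ⋂ j ≥ J, A m j := fun J J' hJ =>
      Set.biInter_subset_biInter_left fun j (hj : J' ≤ j) => hJ.trans hj
    rw [hmono.measure_iUnion]
    refine iSup_le fun J => (measure_mono (Set.biInter_subset_of_mem (le_refl J))).trans ?_
    rw [← ofReal_measureReal]
    exact ENNReal.ofReal_le_ofReal (h.measureReal_sum_ne_truncSum_le m (N J))
  have hlim : Tendsto (fun m : ℕ => ENNReal.ofReal (r * q ^ m)) atTop (𝓝 0) := by
    have := ENNReal.tendsto_ofReal
      ((tendsto_pow_atTop_nhds_zero_of_lt_one h.q_pos.le h.q_lt_one).const_mul r)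
    simpa using this
  rw [ae_iff]
  refine le_antisymm (ge_of_tendsto' hlim fun m => (measure_mono fun ω hω => ?_).trans (hle m))
    bot_le
  simp only [Set.mem_ofPred_eq, not_exists, not_frequently] at hω
  obtain ⟨J, hJ⟩ := eventually_atTop.1 (hω m)
  exact Set.mem_iUnion.2 ⟨J, Set.mem_iInter₂.2 hJ⟩

theorem ae_frequently_div_le (h : IsPetersburgSequence P p q r s X) :
    ∀ᵐ ω ∂P, ∀ c > p * s, ∃ᶠ n : ℕ in atTop,
      (∑ i ∈ Finset.range n, X i ω) / (n * Real.logb r n) ≤ c := by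
  filter_upwards [h.ae_exists_frequently_sum_eq_truncSum fun j => ⌊(2 : ℝ) ^ j⌋₊,
    ae_all_iff.2 fun m => h.ae_tendsto_truncSum m (tendsto_floor_pow_atTop one_lt_two)
      (summable_inv_logb_floor_pow_sq one_lt_two h.one_lt_r)] with ω ⟨m, hm⟩ hT c hc
  refine (tendsto_floor_pow_atTop one_lt_two).frequently
    ((hm.and_eventually ((hT m).eventually_le_const hc)).mono fun j hj => ?_)
  rw [hj.1]
  exact hj.2

/-! ### Large single payoffs -/

/-- The probability that `X n` takes the first level above `M * (n + 1) * log_r (n + 1)` is of the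
order of the reciprocal of that threshold, and these reciprocals have a divergent sum, so the second
Borel–Cantelli lemma applies. -/
theorem ae_frequently_le_payoff (h : IsPetersburgSequence P p q r s X) {M : ℝ} (hM : 0 < M) :
    ∀ᵐ ω ∂P, ∃ᶠ n : ℕ in atTop, M * ((n + 1 : ℕ) * Real.logb r (n + 1 : ℕ)) ≤ X n ω := by
  have hr := h.r_pos
  have hs := h.s_pos
  set x : ℕ → ℝ := fun n => M * ((n + 1 : ℕ) * Real.logb r (n + 1 : ℕ)) with hx
  set k : ℕ → ℕ := fun n => ⌈Real.logb r (x n / s)⌉₊ with hk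
  have hx_top : Tendsto x atTop atTop := by
    have h1 : Tendsto (fun n : ℕ => ((n + 1 : ℕ) : ℝ)) atTop atTop :=
      tendsto_natCast_atTop_atTop.comp (tendsto_add_atTop_nat 1)
    exact (h1.atTop_mul_atTop₀ ((Real.tendsto_logb_atTop h.one_lt_r).comp h1)).const_mul_atTop hM
  have hlow : ∀ᶠ n in atTop, x n ≤ s * r ^ k n := by
    filter_upwards [hx_top.eventually_gt_atTop 0] with n hn
    rw [← div_le_iff₀' hs, ← Real.rpow_natCast,
      ← Real.logb_le_iff_le_rpow h.one_lt_r (by positivity)]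
    exact Nat.le_ceil _
  have hprob : ∀ᶠ n in atTop, p * s / r * (x n)⁻¹ ≤ p * q ^ k n := by
    filter_upwards [hx_top.eventually_ge_atTop s] with n hn
    have hxn : 0 < x n := hs.trans_le hn
    have hupp : r ^ k n ≤ r * (x n / s) := by
      rw [← Real.rpow_natCast, ← Real.le_logb_iff_rpow_le h.one_lt_r (by positivity),
        Real.logb_mul hr.ne' (by positivity), Real.logb_self_eq_one h.one_lt_r, add_comm]
      exact (Nat.ceil_lt_add_one (Real.logb_nonneg h.one_lt_r ((one_le_div hs).2 hn))).le
    have hq : q ^ k n = (r ^ k n)⁻¹ := eq_inv_of_mul_eq_one_left (h.pow_mul_pow _)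
    have e : p * s / r * (x n)⁻¹ = p * (r * (x n / s))⁻¹ := by field_simp
    rw [e, hq]
    have := h.p_pos
    gcongr
  -- Prescribing the value of each payoff gives independent events.
  set B : ℕ → Set Ω := fun n => {ω | X n ω = s * r ^ k n} with hB
  have hBm : ∀ n, MeasurableSet (B n) := fun n => h.measurableSet_level n _
  have hindep : iIndepSet B P := by
    rw [iIndepSet_iff_meas_biInter hBm]
    intro t
    exact h.indep.measure_inter_preimage_eq_mul t fun n _ => measurableSet_singleton (s * r ^ k n)
  have htsum : ∑' n, P (B n) = ⊤ := by
    by_contra hne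
    have hsum : Summable fun n => p * q ^ k n := by
      refine (ENNReal.summable_toReal hne).congr fun n => ?_
      exact h.law n (k n)
    have h1 : Summable fun n => p * s / r * (x n)⁻¹ := by
      refine Summable.of_norm_bounded_eventually_nat hsum ?_
      filter_upwards [hprob, hx_top.eventually_gt_atTop 0] with n hn hx0
      have := h.p_pos
      rwa [Real.norm_of_nonneg (by positivity)]
    have hps : p * s / r ≠ 0 := (div_pos (mul_pos h.p_pos hs) hr).ne'
    rw [summable_mul_left_iff hps] at h1
    simp only [hx, mul_inv M] at h1
    rw [summable_mul_left_iff (inv_ne_zero hM.ne')] at h1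
    exact not_summable_inv_mul_logb h.one_lt_r
      ((summable_nat_add_iff (f := fun n : ℕ => ((n : ℝ) * Real.logb r n)⁻¹) 1).1 h1)
  have hae : ∀ᵐ ω ∂P, ω ∈ limsup B atTop := by
    exact (mem_ae_iff_prob_eq_one (.measurableSet_limsup hBm)).2
      (measure_limsup_eq_one hBm hindep htsum)
  filter_upwards [hae] with ω hω
  rw [mem_limsup_iff_frequently_mem] at hω
  refine (hω.and_eventually hlow).mono fun n hn => ?_
  rw [show X n ω = s * r ^ k n from hn.1]
  exact hn.2

theorem ae_frequently_le_div (h : IsPetersburgSequence P p q r s X) :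
    ∀ᵐ ω ∂P, ∀ c : ℝ, ∃ᶠ n : ℕ in atTop,
      c ≤ (∑ i ∈ Finset.range n, X i ω) / (n * Real.logb r n) := by
  filter_upwards [h.ae_nonneg, ae_all_iff.2 fun M : ℕ =>
    h.ae_frequently_le_payoff (M := M + 1) (by positivity)] with ω hω hf c
  obtain ⟨M, hM⟩ := exists_nat_ge c
  refine (tendsto_add_atTop_nat 1).frequently
    (((hf M).and_eventually (eventually_ge_atTop 1)).mono fun n hn => ?_)
  have hn1 : (1 : ℝ) ≤ n := by exact_mod_cast hn.2
  have hL : 0 < Real.logb r (n + 1 : ℕ) := Real.logb_pos h.one_lt_r (by push_cast; linarith)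
  have hD : (0 : ℝ) < (n + 1 : ℕ) * Real.logb r (n + 1 : ℕ) := by positivity
  rw [le_div_iff₀ hD]
  calc c * ((n + 1 : ℕ) * Real.logb r (n + 1 : ℕ))
      ≤ (M + 1) * ((n + 1 : ℕ) * Real.logb r (n + 1 : ℕ)) := by gcongr; linarith
    _ ≤ X n ω := hn.1
    _ ≤ ∑ i ∈ Finset.range (n + 1), X i ω :=
      Finset.single_le_sum (fun i _ => hω i) (Finset.self_mem_range_succ n)

end IsPetersburgSequence

/-! ### The almost sure upper and lower limits -/

/-- The payoffs `X_1, X_2, …` of the successive games are `X 0, X 1, …`, so that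
`S_n = ∑ i ∈ Finset.range n, X i` is the sum of the first `n` payoffs. The upper and lower limits
are taken in the extended reals. -/
theorem mainTheorem9 {Ω : Type*} [MeasurableSpace Ω] (P : Measure Ω) [IsProbabilityMeasure P]
    (p q r s : ℝ) (hp : 0 < p) (hp1 : p < 1) (hpq : p + q = 1) (hs : 0 < s) (hr : r = 1 / q)
    (X : ℕ → Ω → ℝ) (hmeas : ∀ i, Measurable (X i)) (hindep : iIndepFun X P)
    (hlaw : ∀ i, ∀ k : ℕ, 1 ≤ k →
      P {ω | X i ω = s * r ^ (k - 1)} = ENNReal.ofReal (p * q ^ (k - 1))) :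
    (∀ᵐ ω ∂P, limsup (fun n : ℕ =>
        (((∑ i ∈ Finset.range n, X i ω) / ((n : ℝ) * Real.logb r n) : ℝ) : EReal)) atTop
          = ⊤) ∧
    (∀ᵐ ω ∂P, liminf (fun n : ℕ =>
        (((∑ i ∈ Finset.range n, X i ω) / ((n : ℝ) * Real.logb r n) : ℝ) : EReal)) atTop
          = ((p * s : ℝ) : EReal)) := by
  have hq : 0 < q := by linarith
  have h : IsPetersburgSequence P p q r s X :=
    { p_pos := hp
      q_pos := hq
      add_eq_one := hpq
      mul_eq_one := by rw [hr]; field_simp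
      s_pos := hs
      measurable := hmeas
      indep := hindep
      law := fun i k => by
        have := hlaw i (k + 1) (by omega)
        simp only [Nat.add_sub_cancel] at this
        rw [measureReal_def, this, ENNReal.toReal_ofReal (by positivity)] }
  constructor
  · filter_upwards [h.ae_frequently_le_div] with ω hω
    refine EReal.eq_top_iff_forall_lt _ |>.2 fun c => ?_
    refine lt_of_lt_of_le (EReal.coe_lt_coe_iff.2 (lt_add_one c)) (le_limsup_of_frequently_le' ?_)
    exact (hω (c + 1)).mono fun n hn => EReal.coe_le_coe_iff.2 hn
  -- The factors `a = 1 + 1 / (l + 1)` decrease to `1`.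
  · filter_upwards [h.ae_frequently_div_le, ae_all_iff.2 fun l : ℕ =>
      h.ae_eventually_le_div (a := 1 + 1 / ((l : ℝ) + 1)) (by simp; positivity)] with ω hup hlow
    refine le_antisymm ?_ ?_
    · refine EReal.le_of_forall_lt_iff_le.1 fun c hc => ?_
      refine liminf_le_of_frequently_le' ?_
      exact (hup c (EReal.coe_lt_coe_iff.1 hc)).mono fun n hn => EReal.coe_le_coe_iff.2 hn
    · refine EReal.ge_of_forall_gt_iff_ge.1 fun c hc => ?_
      have hlim : Tendsto (fun l : ℕ => p * s * (1 + 1 / ((l : ℝ) + 1))⁻¹) atTop (𝓝 (p * s)) := by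
        have := ((tendsto_one_div_add_atTop_nhds_zero_nat (𝕜 := ℝ)).const_add 1).inv₀
          (by norm_num) |>.const_mul (p * s)
        simpa using this
      obtain ⟨l, hl⟩ := (hlim.eventually_const_lt (EReal.coe_lt_coe_iff.1 hc)).exists
      refine le_liminf_of_le (by isBoundedDefault) ?_
      exact (hlow l c hl).mono fun n hn => EReal.coe_le_coe_iff.2 hn
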